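/- For a planar triangle, that is, a triple $\Delta=(x_0,x_1,x_2)$ of non-collinear points of $\mathbb{R}^2$, with centroid $c=\frac13(x_0+x_1+x_2)$ and indices modulo $3$, put $r_i=\|x_{i-1}-c\|\,\|x_i-c\|^{-1}$ and $$\theta_0(\Delta)=(x_0',x_1',x_2'),\qquad x_i'=\tfrac13\bigl(2r_i(x_i-c)-r_{i+1}(x_{i+1}-c)-r_{i-1}(x_{i-1}-c)\bigr)+c .$$ Let $\theta(\Delta)$ be $\theta_0(\Delta)$ rescaled by the factor $s=\sqrt{\operatorname{area}(\Delta)/\operatorname{area}(\theta_0(\Delta))}$, so that $\theta$ preserves the area. The rescaling may be read in two ways: about the centroid, $x_i'\mapsto c+s(x_i'-c)$, or about the origin, $\theta(\Delta)=s\,\theta_0(\Delta)$; the theorem is asserted for each of the two resulting maps $\theta$. Let $\Delta_{eq}$ be an equilateral planar triangle, let $\Lambda$ be the set of all triples $(y_0,y_1,y_2)$ similar to it, i.e. $y_i=a(Ax_i+\sigma)$ for $i=0,1,2$ with some $A\in SO(2)$, $\sigma\in\mathbb{R}^2$, $a>0$, where $\Delta_{eq}=(x_0,x_1,x_2)$,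 and let $X$ be the set of planar triangles with the same orientation as $\Delta_{eq}$ (if $\Delta_{eq}$ is indexed counter-clockwise: all triangles indexed counter-clockwise). Let $\|\Delta\|=\max_i\|x_i\|$. Then $\Lambda$ is a global attractor for $\theta$ on $X$: $\theta$ maps $X$ to $X$; $\Lambda$ is a nonempty, relatively closed subset of $X$ with $\theta(\Lambda)=\Lambda$; $\Lambda$ is stable (for every $\varepsilon>0$ there is $\delta>0$ such that $\Delta\in X$, $\operatorname{dist}(\Delta,\Lambda)<\delta$ imply $\operatorname{dist}(\theta^n(\Delta),\Lambda)<\varepsilon$ for all $n\ge 0$); and $\operatorname{dist}(\theta^n(\Delta),\Lambda)\to0$ as $n\to\infty$, uniformly for $\Delta$ in any bounded subset of $X$. Moreover, for any triangle $\Delta \in X$ the sequence $\theta^n(\Delta)$ converges uniformly at an exponential rate to one point of $\Lambda$: there are constants $C$ and $0<q<1$ such that for every $\Delta\in X$ there is $L\in\Lambda$ with $$\|\theta^n(\Delta)-L\|\le C\,\|\Delta\|\,q^n\qquad\text{for all } n\ge 0 .$$ -/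

import Mathlib

noncomputable section

namespace TriangleMap

/-- The euclidean plane. -/
abbrev Plane : Type := EuclideanSpace ℝ (Fin 2)

/-- Ordered triples of points of the plane. Arithmetic on the index type `Fin 3` is modulo `3`.
The norm of a triple is the largest euclidean norm of its three entries. -/
abbrev Triple : Type := Fin 3 → Plane

/-- The set of planar triangles: triples of non-collinear points. -/
def triangles : Set Triple := {T | ¬ Collinear ℝ (Set.range T)}

/-- The centroid of a triple. -/
def centroid (T : Triple) : Plane := (1 / 3 : ℝ) • (T 0 + T 1 + T 2)

/-- The signed area of a triangle, positive iff its vertices are in counter-clockwise order. -/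
def signedArea (T : Triple) : ℝ :=
  ((T 1 0 - T 0 0) * (T 2 1 - T 0 1) - (T 1 1 - T 0 1) * (T 2 0 - T 0 0)) / 2

/-- The area of a triangle. -/
def area (T : Triple) : ℝ := |signedArea T|

/-- The quotient `r i` of the distances to the centroid of the vertices `i - 1` and `i`. -/
def ratio (T : Triple) (i : Fin 3) : ℝ :=
  ‖T (i - 1) - centroid T‖ * ‖T i - centroid T‖⁻¹

/-- The centroid-preserving transformation, before the area is normalized. -/
def step (T : Triple) : Triple := fun i =>
  (1 / 3 : ℝ) • ((2 * ratio T i) • (T i - centroid T)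
      - ratio T (i + 1) • (T (i + 1) - centroid T)
      - ratio T (i - 1) • (T (i - 1) - centroid T))
    + centroid T

/-- The scaling factor which gives `step T` the area of `T`. -/
def areaFactor (T : Triple) : ℝ := Real.sqrt ((area (step T))⁻¹ * area T)

/-- The triangle transformation, where `step T` is rescaled about its centroid to the area
of `T`. -/
def theta (T : Triple) : Triple := fun i =>
  centroid (step T) + areaFactor T • (step T i - centroid (step T))

/-- The triangle transformation, where `step T`, as a vector, is multiplied by the scaling
factor, that is, where it is rescaled about the origin to the area of `T`. -/
def thetaOrigin (T : Triple) : Triple := areaFactor T • step T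

/-- Similarity of triples: they are related by a rotation, a translation and a positive
scaling, which respect the numbering of the vertices. -/
def Similar (S T : Triple) : Prop :=
  ∃ A ∈ Matrix.specialOrthogonalGroup (Fin 2) ℝ, ∃ v : Plane, ∃ a : ℝ, 0 < a ∧
    ∀ i, a • (Matrix.toEuclideanLin A (S i) + v) = T i

/-- The set of triples similar to a given one. -/
def similarityClass (S : Triple) : Set Triple := {T | Similar S T}

/-- All three sides have the same length. -/
def IsEquilateral (T : Triple) : Prop :=
  dist (T 0) (T 1) = dist (T 1) (T 2) ∧ dist (T 1) (T 2) = dist (T 2) (T 0)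

/-- The set of planar triangles with the orientation of `S`. If `S` is numbered
counter-clockwise, these are the triangles numbered counter-clockwise. -/
def trianglesOriented (S : Triple) : Set Triple :=
  {T | T ∈ triangles ∧ 0 < signedArea S * signedArea T}

/-- `K` is a global attractor for the self-map `f` of the subset `X` of a metric space:
a nonempty relatively closed subset of `X`, invariant under `f`, (uniformly) Lyapunov stable,
which attracts every bounded subset of `X` uniformly. -/
structure IsGlobalAttractor {M : Type*} [PseudoMetricSpace M] (f : M → M) (X K : Set M) :
    Prop where
  mapsTo : Set.MapsTo f X X
  nonempty : K.Nonempty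
  subset : K ⊆ X
  isClosed : closure K ∩ X ⊆ K
  invariant : f '' K = K
  stable : ∀ ε > 0, ∃ δ > 0, ∀ x ∈ X, Metric.infDist x K < δ →
    ∀ n : ℕ, Metric.infDist (f^[n] x) K < ε
  attracts : ∀ B ⊆ X, Bornology.IsBounded B → ∀ ε > 0, ∃ N : ℕ, ∀ n ≥ N, ∀ x ∈ B,
    Metric.infDist (f^[n] x) K < ε

end TriangleMap

end

/-! Centre the triangle at its centroid and let `a, b, c` be the distances of the vertices to it.
The map first turns these lengths cyclically along the three rays, then subtracts the mean of the
new vectors. The first operation keeps the sum of squared lengths `size` and the second can only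
lower it, while the area is multiplied by `growth`, the mean of `b/a`, `c/b`, `a/c`, which is at
least `1` by AM-GM. Restoring the area therefore divides the bound on `size` by `growth`.

The Lyapunov function is `defect = size - 4/√3 * area`, nonnegative by Weitzenböck's inequality and
zero exactly on equilateral shapes among nondegenerate triangles. Since the area is kept, one
application lowers it by at least `(1 - growth⁻¹) * size`. This gain controls the sum of squared
differences of `a, b, c` (`sq_diffs_le_one_sub_inv`), which in turn controls `defect` by a
Heron-type identity (`defect_le_sq_diffs`); so `defect` shrinks by the factor `15/16`
(`defect_rescale_le`).

The converse estimates bound the displacement of a triangle by a multiple of `√defect`, plus a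
centroid term when rescaling about the origin. Orbits are then Cauchy at a geometric rate. The limit
keeps the nonzero signed area and has zero defect, hence is similar to `E`. Stability and uniform
attraction follow because `√defect` is comparable to the distance to the similarity class. -/

noncomputable section

namespace TriangleMap

/-! ### Inequalities for three positive numbers -/

/-- With `q = u² - uv + v²`, the sum of squared differences is `2q`, and the cyclic sum minus three
times the product is `aq + uv²`. In the right side minus the left side, the coefficients of `a³`,
`a²`, `a`, `1` are `6q`, `2q(u+v) + 12uv²`, `2q(u-v)² + 8uv²(u+v)` and `2uv²(u² + uv + v²)`, all
nonnegative. -/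
lemma sq_diffs_mul_cyclic_le_aux {a u v : ℝ} (ha : 0 ≤ a) (hu : 0 ≤ u) (hv : 0 ≤ v) :
    ((a - (a + u)) ^ 2 + (a + u - (a + v)) ^ 2 + (a + v - a) ^ 2) *
        (a ^ 2 * (a + v) + (a + u) ^ 2 * a + (a + v) ^ 2 * (a + u)) ≤
      4 * ((a ^ 2 * (a + v) + (a + u) ^ 2 * a + (a + v) ^ 2 * (a + u)
        - 3 * (a * (a + u) * (a + v))) * (a ^ 2 + (a + u) ^ 2 + (a + v) ^ 2)) := by
  have hq : 0 ≤ u ^ 2 - u * v + v ^ 2 := by nlinarith [sq_nonneg (u - v), mul_nonneg hu hv]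
  have h3 : 0 ≤ a ^ 3 * (u ^ 2 - u * v + v ^ 2) := by positivity
  have h2 : 0 ≤ a ^ 2 * ((u ^ 2 - u * v + v ^ 2) * (u + v)) := by positivity
  have h2' : 0 ≤ a ^ 2 * (u * v ^ 2) := by positivity
  have h1 : 0 ≤ a * ((u ^ 2 - u * v + v ^ 2) * (u - v) ^ 2) := by positivity
  have h1' : 0 ≤ a * (u * v ^ 2 * (u + v)) := by positivity
  have h1'' : 0 ≤ a * ((u ^ 2 - u * v + v ^ 2) * (u ^ 2 + v ^ 2)) := by positivity
  have h0 : 0 ≤ u * v ^ 2 * (u ^ 2 + v ^ 2) := by positivity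
  have h0' : 0 ≤ u * v ^ 2 * (u * v) := by positivity
  nlinarith

lemma cyclic_mul_le_sq_diffs_aux {a u v : ℝ} (ha : 0 ≤ a) (hu : 0 ≤ u) (hv : 0 ≤ v) :
    (a ^ 2 * (a + v) + (a + u) ^ 2 * a + (a + v) ^ 2 * (a + u)
        - 3 * (a * (a + u) * (a + v))) * (a ^ 2 + (a + u) ^ 2 + (a + v) ^ 2) ≤
      2 * (((a - (a + u)) ^ 2 + (a + u - (a + v)) ^ 2 + (a + v - a) ^ 2) *
        (a ^ 2 * (a + v) + (a + u) ^ 2 * a + (a + v) ^ 2 * (a + u))) := by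
  have hq : 0 ≤ u ^ 2 - u * v + v ^ 2 := by nlinarith [sq_nonneg (u - v), mul_nonneg hu hv]
  -- `(u+v)(u-v)² ≥ 0` gives `u³ + v³ ≥ u²v + uv²`.
  have hc : 0 ≤ u ^ 3 + v ^ 3 - u * v ^ 2 := by
    have := mul_nonneg (add_nonneg hu hv) (sq_nonneg (u - v))
    have := mul_nonneg hu (mul_nonneg hu hv)
    have : 0 ≤ u ^ 3 := by positivity
    have : 0 ≤ v ^ 3 := by positivity
    nlinarith
  have h3 : 0 ≤ a ^ 3 * (u ^ 2 - u * v + v ^ 2) := by positivity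
  have h2 : 0 ≤ a ^ 2 * ((u ^ 2 - u * v + v ^ 2) * (u + v)) := by positivity
  have h2' : 0 ≤ a ^ 2 * (u ^ 3 + v ^ 3 - u * v ^ 2) := by positivity
  have h1 : 0 ≤ a * ((u ^ 2 - u * v + v ^ 2) * (u * v)) := by positivity
  have h1' : 0 ≤ a * ((u ^ 3 + v ^ 3 - u * v ^ 2) * (u + v)) := by positivity
  have h1'' : 0 ≤ a * ((u ^ 2 - u * v + v ^ 2) * (u ^ 2 + v ^ 2)) := by positivity
  have h0 : 0 ≤ u * v ^ 2 * (u - v) ^ 2 := by positivity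
  have h0' : 0 ≤ u * v ^ 2 * (u ^ 2 - u * v + v ^ 2) := by positivity
  nlinarith

/-- A cyclically invariant statement about three positive numbers may be proved assuming that the
first one is the smallest. -/
lemma cyclic_induction {p : ℝ → ℝ → ℝ → Prop} (hp : ∀ a b c, p a b c → p b c a)
    (h : ∀ a u v : ℝ, 0 ≤ a → 0 ≤ u → 0 ≤ v → p a (a + u) (a + v)) {a b c : ℝ}
    (ha : 0 ≤ a) (hb : 0 ≤ b) (hc : 0 ≤ c) : p a b c := by
  have key : ∀ {x y z : ℝ}, 0 ≤ x → x ≤ y → x ≤ z → p x y z := fun {x y z} hx hy hz => by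
    simpa using h x (y - x) (z - x) hx (sub_nonneg.2 hy) (sub_nonneg.2 hz)
  rcases le_total a b with hab | hab <;> rcases le_total b c with hbc | hbc <;>
    rcases le_total a c with hac | hac
  · exact key ha hab hac
  · exact key ha hab (hab.trans hbc)
  · exact key ha hab hac
  · exact hp _ _ _ (key hc hac hbc)
  · exact hp _ _ _ (hp _ _ _ (key hb hbc hab))
  · exact hp _ _ _ (hp _ _ _ (key hb hbc hab))
  · exact hp _ _ _ (key hc (hbc.trans hab) hbc)
  · exact hp _ _ _ (key hc hac hbc)

lemma sq_diffs_mul_cyclic_le {a b c : ℝ} (ha : 0 ≤ a) (hb : 0 ≤ b) (hc : 0 ≤ c) :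
    ((a - b) ^ 2 + (b - c) ^ 2 + (c - a) ^ 2) * (a ^ 2 * c + b ^ 2 * a + c ^ 2 * b) ≤
      4 * ((a ^ 2 * c + b ^ 2 * a + c ^ 2 * b - 3 * (a * b * c)) *
        (a ^ 2 + b ^ 2 + c ^ 2)) := by
  refine cyclic_induction (p := fun a b c =>
    ((a - b) ^ 2 + (b - c) ^ 2 + (c - a) ^ 2) * (a ^ 2 * c + b ^ 2 * a + c ^ 2 * b) ≤
      4 * ((a ^ 2 * c + b ^ 2 * a + c ^ 2 * b - 3 * (a * b * c)) *
        (a ^ 2 + b ^ 2 + c ^ 2))) (fun a b c h => by linarith)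
    (fun a u v h1 h2 h3 => sq_diffs_mul_cyclic_le_aux h1 h2 h3) ha hb hc

lemma cyclic_mul_le_sq_diffs {a b c : ℝ} (ha : 0 ≤ a) (hb : 0 ≤ b) (hc : 0 ≤ c) :
    (a ^ 2 * c + b ^ 2 * a + c ^ 2 * b - 3 * (a * b * c)) * (a ^ 2 + b ^ 2 + c ^ 2) ≤
      2 * (((a - b) ^ 2 + (b - c) ^ 2 + (c - a) ^ 2) *
        (a ^ 2 * c + b ^ 2 * a + c ^ 2 * b)) := by
  refine cyclic_induction (p := fun a b c =>
    (a ^ 2 * c + b ^ 2 * a + c ^ 2 * b - 3 * (a * b * c)) * (a ^ 2 + b ^ 2 + c ^ 2) ≤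
      2 * (((a - b) ^ 2 + (b - c) ^ 2 + (c - a) ^ 2) *
        (a ^ 2 * c + b ^ 2 * a + c ^ 2 * b))) (fun a b c h => by linarith)
    (fun a u v h1 h2 h3 => cyclic_mul_le_sq_diffs_aux h1 h2 h3) ha hb hc

/-- One third of the cyclic sum of the quotients of three numbers. -/
def meanQuotient (a b c : ℝ) : ℝ := (b / a + c / b + a / c) / 3

lemma one_sub_inv_meanQuotient {a b c : ℝ} (ha : 0 < a) (hb : 0 < b) (hc : 0 < c) :
    1 - (meanQuotient a b c)⁻¹ =
      (a ^ 2 * b + c ^ 2 * a + b ^ 2 * c - 3 * (a * c * b)) /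
        (a ^ 2 * b + c ^ 2 * a + b ^ 2 * c) := by
  have h : meanQuotient a b c = (a ^ 2 * b + c ^ 2 * a + b ^ 2 * c) / (3 * (a * c * b)) := by
    unfold meanQuotient
    field_simp
    ring
  rw [h, inv_div]
  field_simp

lemma meanQuotient_pos {a b c : ℝ} (ha : 0 < a) (hb : 0 < b) (hc : 0 < c) :
    0 < meanQuotient a b c := by
  unfold meanQuotient; positivity

lemma sq_diffs_le_one_sub_inv {a b c : ℝ} (ha : 0 < a) (hb : 0 < b) (hc : 0 < c) :
    (a - b) ^ 2 + (b - c) ^ 2 + (c - a) ^ 2 ≤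
      4 * ((1 - (meanQuotient a b c)⁻¹) * (a ^ 2 + b ^ 2 + c ^ 2)) := by
  rw [one_sub_inv_meanQuotient ha hb hc]
  -- Over the denominator `abc`, the quotient sum runs through the cycle in the opposite direction,
  -- hence the exchange of `b` and `c`.
  have h := sq_diffs_mul_cyclic_le ha.le hc.le hb.le
  have hP : 0 < a ^ 2 * b + c ^ 2 * a + b ^ 2 * c := by positivity
  rw [div_mul_eq_mul_div, mul_div_assoc', le_div_iff₀ hP]
  linarith

lemma one_sub_inv_le_sq_diffs {a b c : ℝ} (ha : 0 < a) (hb : 0 < b) (hc : 0 < c) :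
    (1 - (meanQuotient a b c)⁻¹) * (a ^ 2 + b ^ 2 + c ^ 2) ≤
      2 * ((a - b) ^ 2 + (b - c) ^ 2 + (c - a) ^ 2) := by
  rw [one_sub_inv_meanQuotient ha hb hc]
  have h := cyclic_mul_le_sq_diffs ha.le hc.le hb.le
  have hP : 0 < a ^ 2 * b + c ^ 2 * a + b ^ 2 * c := by positivity
  rw [div_mul_eq_mul_div, div_le_iff₀ hP]
  linarith

lemma one_le_meanQuotient {a b c : ℝ} (ha : 0 < a) (hb : 0 < b) (hc : 0 < c) :
    1 ≤ meanQuotient a b c := by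
  have h := sq_diffs_le_one_sub_inv ha hb hc
  have hS : 0 < a ^ 2 + b ^ 2 + c ^ 2 := by positivity
  have h1 : 0 ≤ 1 - (meanQuotient a b c)⁻¹ := by
    by_contra! hneg
    nlinarith [mul_pos (neg_pos.2 hneg) hS, sq_nonneg (a - b), sq_nonneg (b - c),
      sq_nonneg (c - a)]
  exact (inv_le_one₀ (meanQuotient_pos ha hb hc)).1 (by linarith)

/-! ### Centred triples -/

lemma norm_sq_plane (v : Plane) : ‖v‖ ^ 2 = v 0 ^ 2 + v 1 ^ 2 := by
  rw [EuclideanSpace.real_norm_sq_eq, Fin.sum_univ_two]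

/-- The position of a vertex relative to the centroid. -/
def ctr (T : Triple) (i : Fin 3) : Plane := T i - centroid T

/-- The sum of the squared distances of the vertices to the centroid. -/
def size (T : Triple) : ℝ := ‖ctr T 0‖ ^ 2 + ‖ctr T 1‖ ^ 2 + ‖ctr T 2‖ ^ 2

/-- The deficit in Weitzenböck's inequality; it vanishes for equilateral triangles only. -/
def defect (T : Triple) : ℝ := size T - 4 / √3 * area T

lemma ctr_apply (T : Triple) (i : Fin 3) (j : Fin 2) :
    ctr T i j = T i j - (T 0 j + T 1 j + T 2 j) / 3 := by
  simp [ctr, centroid]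
  ring

lemma ctr_sum (T : Triple) : ctr T 0 + ctr T 1 + ctr T 2 = 0 := by
  ext j
  simp only [PiLp.add_apply, ctr_apply, PiLp.zero_apply]
  ring

lemma ctr_two (T : Triple) : ctr T 2 = -(ctr T 0 + ctr T 1) :=
  eq_neg_of_add_eq_zero_right (ctr_sum T)

lemma centroid_add_ctr (T : Triple) (i : Fin 3) : centroid T + ctr T i = T i := by
  simp [ctr]

lemma signedArea_eq (T : Triple) :
    signedArea T = 3 / 2 * (ctr T 0 0 * ctr T 1 1 - ctr T 0 1 * ctr T 1 0) := by
  simp only [signedArea, ctr_apply]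
  ring

lemma centroid_eq_of_add_ctr {T : Triple} {c : Plane} {y : Fin 3 → Plane}
    (hy : y 0 + y 1 + y 2 = 0) (hT : ∀ i, T i = c + y i) : centroid T = c := by
  have h : T 0 + T 1 + T 2 = (3 : ℝ) • c := by
    rw [hT, hT, hT]
    calc c + y 0 + (c + y 1) + (c + y 2) = c + c + c + (y 0 + y 1 + y 2) := by abel
      _ = (3 : ℝ) • c := by rw [hy]; module
  rw [centroid, h, smul_smul]
  norm_num

lemma ctr_eq_of_add_ctr {T : Triple} {c : Plane} {y : Fin 3 → Plane}
    (hy : y 0 + y 1 + y 2 = 0) (hT : ∀ i, T i = c + y i) (i : Fin 3) : ctr T i = y i := by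
  rw [ctr, centroid_eq_of_add_ctr hy hT, hT]
  simp

lemma size_nonneg (T : Triple) : 0 ≤ size T := by unfold size; positivity

/-- A linear function of the triple which vanishes iff the triple is an equilateral triangle
whose orientation is given by the sign `σ`. -/
def skew (σ : ℝ) (T : Triple) : Plane :=
  ctr T 1 + (1 / 2 : ℝ) • ctr T 0 - (σ * √3 / 2) • !₂[-(ctr T 0 1), ctr T 0 0]

/-- In complex notation `skew σ T` is `x₁ - ω x₀` for the centred vertices, with `ω = (-1 + σ i √3)
/ 2` a primitive cube root of unity. Writing the defect as the squared norm of a linear map gives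
both Weitzenböck's inequality and its equality case. -/
lemma size_sub_eq_norm_skew_sq {σ : ℝ} (hσ : σ ^ 2 = 1) (T : Triple) :
    size T - 4 / √3 * (σ * signedArea T) = 2 * ‖skew σ T‖ ^ 2 := by
  have h3 : √3 ^ 2 = (3 : ℝ) := Real.sq_sqrt (by norm_num)
  have h4 : 4 / √3 = 4 * √3 / 3 := by
    rw [div_eq_div_iff (by positivity) (by norm_num)]
    linarith
  rw [h4, size, ctr_two, signedArea_eq]
  simp only [norm_sq_plane, skew, PiLp.add_apply, PiLp.sub_apply, PiLp.neg_apply,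
    PiLp.smul_apply, smul_eq_mul, Matrix.cons_val_zero, Matrix.cons_val_one]
  linear_combination (-(ctr T 0 0 ^ 2 + ctr T 0 1 ^ 2) / 2 * √3 ^ 2) * hσ -
    (ctr T 0 0 ^ 2 + ctr T 0 1 ^ 2) / 2 * h3

lemma exists_sign (T : Triple) : ∃ σ : ℝ, σ ^ 2 = 1 ∧ area T = σ * signedArea T := by
  rcases abs_choice (signedArea T) with h | h
  · exact ⟨1, by norm_num, by simp [area, h]⟩
  · exact ⟨-1, by norm_num, by simp [area, h]⟩

lemma defect_nonneg (T : Triple) : 0 ≤ defect T := by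
  obtain ⟨σ, h1, h2⟩ := exists_sign T
  rw [defect, h2, size_sub_eq_norm_skew_sq h1]
  positivity

lemma area_nonneg (T : Triple) : 0 ≤ area T := abs_nonneg _

lemma defect_le_size (T : Triple) : defect T ≤ size T := by
  have := mul_nonneg (by positivity : 0 ≤ 4 / √3) (area_nonneg T)
  unfold defect
  linarith

lemma area_le_size (T : Triple) : 4 / √3 * area T ≤ size T := by
  have := defect_nonneg T
  unfold defect at this
  linarith

/-- Heron's formula for the triangle whose sides are the distances of the vertices to the
centroid. -/
lemma size_sq_sub (T : Triple) :
    size T ^ 2 - (4 / √3 * area T) ^ 2 =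
      2 * ((‖ctr T 0‖ ^ 2 - ‖ctr T 1‖ ^ 2) ^ 2 + (‖ctr T 1‖ ^ 2 - ‖ctr T 2‖ ^ 2) ^ 2 +
        (‖ctr T 2‖ ^ 2 - ‖ctr T 0‖ ^ 2) ^ 2) := by
  have h3 : √3 ^ 2 = (3 : ℝ) := Real.sq_sqrt (by norm_num)
  rw [mul_pow, div_pow, h3, area, sq_abs, signedArea_eq, size, ctr_two]
  simp only [norm_sq_plane, PiLp.add_apply, PiLp.neg_apply]
  ring

/-- `size_sq_sub` factors as `defect` times a factor at least `size`, and each `(x² - y²)²` is at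
most `2 * size * (x - y)²`; then `size` cancels. -/
lemma defect_le_sq_diffs (T : Triple) :
    defect T ≤ 4 * ((‖ctr T 0‖ - ‖ctr T 1‖) ^ 2 + (‖ctr T 1‖ - ‖ctr T 2‖) ^ 2 +
        (‖ctr T 2‖ - ‖ctr T 0‖) ^ 2) := by
  rcases (size_nonneg T).eq_or_lt with h0 | h0
  · have := defect_le_size T
    rw [← h0] at this
    exact this.trans (by positivity)
  have h := size_sq_sub T
  have hS := area_le_size T
  have hA : 0 ≤ 4 / √3 * area T := mul_nonneg (by positivity) (area_nonneg T)
  set a := ‖ctr T 0‖ with ha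
  set b := ‖ctr T 1‖ with hb
  set c := ‖ctr T 2‖ with hc
  have hs : size T = a ^ 2 + b ^ 2 + c ^ 2 := rfl
  have aux : ∀ x y z : ℝ, (x ^ 2 - y ^ 2) ^ 2 ≤ (x - y) ^ 2 * (2 * (x ^ 2 + y ^ 2 + z ^ 2)) := by
    intro x y z
    have : (x + y) ^ 2 ≤ 2 * (x ^ 2 + y ^ 2 + z ^ 2) := by
      nlinarith [sq_nonneg (x - y), sq_nonneg z]
    calc (x ^ 2 - y ^ 2) ^ 2 = (x - y) ^ 2 * (x + y) ^ 2 := by ring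
      _ ≤ _ := mul_le_mul_of_nonneg_left this (sq_nonneg _)
  have h1 := aux a b c
  have h2 := aux b c a
  have h3 := aux c a b
  have h4 : defect T * size T ≤ size T ^ 2 - (4 / √3 * area T) ^ 2 := by
    unfold defect
    nlinarith
  refine le_of_mul_le_mul_right (h4.trans ?_) h0
  rw [h, hs]
  linarith

/-- The triangle inequality `c ≤ a + b` makes `S` at most `2(a+b)²`, so `(a² - b²)²` dominates a
multiple of `S (a - b)²`. It applies to the distances to the centroid because the centred vectors
sum to zero. -/
lemma sq_sub_le_two_defect {a b c S A : ℝ} (ha : 0 < a) (hb : 0 < b) (hc : 0 ≤ c)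
    (hcab : c ≤ a + b) (hS : S = a ^ 2 + b ^ 2 + c ^ 2) (hAS : A ≤ S)
    (h : S ^ 2 - A ^ 2 = 2 * ((a ^ 2 - b ^ 2) ^ 2 + (b ^ 2 - c ^ 2) ^ 2 +
      (c ^ 2 - a ^ 2) ^ 2)) : (a - b) ^ 2 ≤ 2 * (S - A) := by
  have h0 : 0 < S := by rw [hS]; positivity
  have h1 : S ≤ 2 * (a + b) ^ 2 := by
    rw [hS]
    nlinarith [mul_pos ha hb]
  have h2 : 2 * ((a - b) ^ 2 * (a + b) ^ 2) ≤ (S - A) * (2 * S) := by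
    calc 2 * ((a - b) ^ 2 * (a + b) ^ 2) = 2 * (a ^ 2 - b ^ 2) ^ 2 := by ring
      _ ≤ S ^ 2 - A ^ 2 := by rw [h]; nlinarith [sq_nonneg (b ^ 2 - c ^ 2), sq_nonneg (c ^ 2 - a ^ 2)]
      _ ≤ (S - A) * (2 * S) := by nlinarith
  have h3 : (a - b) ^ 2 * S ≤ 2 * ((a - b) ^ 2 * (a + b) ^ 2) := by
    nlinarith [mul_le_mul_of_nonneg_left h1 (sq_nonneg (a - b))]
  refine le_of_mul_le_mul_right ?_ h0
  linarith

lemma norm_le_add_of_sum_eq_zero {u v w : Plane} (h : u + v + w = 0) : ‖w‖ ≤ ‖u‖ + ‖v‖ := by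
  rw [eq_neg_of_add_eq_zero_right h, norm_neg]
  exact norm_add_le u v

lemma ctr_pos {T : Triple} (hT : signedArea T ≠ 0) (i : Fin 3) : 0 < ‖ctr T i‖ := by
  rw [norm_pos_iff]
  intro h
  apply hT
  rw [signedArea_eq]
  have hx : ∀ j, ctr T 2 j = -(ctr T 0 j + ctr T 1 j) := fun j => by rw [ctr_two]; simp
  have h0 := hx 0
  have h1 := hx 1
  have hi : ∀ j, ctr T i j = 0 := fun j => by rw [h]; rfl
  have hi0 := hi 0
  have hi1 := hi 1
  fin_cases i <;> simp only [Fin.zero_eta, Fin.mk_one, Fin.reduceFinMk] at hi0 hi1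
  · rw [hi0, hi1]
    ring
  · rw [hi0, hi1]
    ring
  · linear_combination (3 / 2 : ℝ) * (ctr T 1 1 * h0 - ctr T 1 0 * h1) -
      (3 / 2 : ℝ) * (ctr T 1 1 * hi0 - ctr T 1 0 * hi1)

lemma size_pos {T : Triple} (hT : signedArea T ≠ 0) : 0 < size T := by
  have := ctr_pos hT 0
  unfold size
  positivity

lemma sq_sub_norm_ctr_le {T : Triple} (hT : signedArea T ≠ 0) (i j : Fin 3) :
    (‖ctr T i‖ - ‖ctr T j‖) ^ 2 ≤ 2 * defect T := by
  have h := size_sq_sub T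
  have hs := ctr_sum T
  have h01 := sq_sub_le_two_defect (ctr_pos hT 0) (ctr_pos hT 1) (ctr_pos hT 2).le
    (norm_le_add_of_sum_eq_zero hs) rfl (area_le_size T) h
  have h12 := sq_sub_le_two_defect (S := size T) (ctr_pos hT 1) (ctr_pos hT 2) (ctr_pos hT 0).le
    (norm_le_add_of_sum_eq_zero (by rw [← hs]; abel)) (by unfold size; ring) (area_le_size T)
    (by rw [h]; ring)
  have h20 := sq_sub_le_two_defect (S := size T) (ctr_pos hT 2) (ctr_pos hT 0) (ctr_pos hT 1).le
    (norm_le_add_of_sum_eq_zero (by rw [← hs]; abel)) (by unfold size; ring) (area_le_size T)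
    (by rw [h]; ring)
  have h0 := defect_nonneg T
  change _ ≤ 2 * defect T at h01 h12 h20
  fin_cases i <;> fin_cases j <;>
    simp only [Fin.zero_eta, Fin.mk_one, Fin.reduceFinMk] <;> linarith

/-! ### The transformation before rescaling -/

/-- The factor by which `step` changes the area. -/
def growth (T : Triple) : ℝ := meanQuotient ‖ctr T 0‖ ‖ctr T 1‖ ‖ctr T 2‖

lemma growth_pos {T : Triple} (hT : signedArea T ≠ 0) : 0 < growth T :=
  meanQuotient_pos (ctr_pos hT 0) (ctr_pos hT 1) (ctr_pos hT 2)

lemma one_le_growth {T : Triple} (hT : signedArea T ≠ 0) : 1 ≤ growth T :=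
  one_le_meanQuotient (ctr_pos hT 0) (ctr_pos hT 1) (ctr_pos hT 2)

lemma defect_le_one_sub_inv_growth {T : Triple} (hT : signedArea T ≠ 0) :
    defect T ≤ 16 * ((1 - (growth T)⁻¹) * size T) := by
  have h := sq_diffs_le_one_sub_inv (ctr_pos hT 0) (ctr_pos hT 1) (ctr_pos hT 2)
  change _ ≤ 4 * ((1 - (growth T)⁻¹) * size T) at h
  linarith [defect_le_sq_diffs T]

lemma one_sub_inv_growth_le_defect {T : Triple} (hT : signedArea T ≠ 0) :
    (1 - (growth T)⁻¹) * size T ≤ 12 * defect T := by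
  have h := one_sub_inv_le_sq_diffs (ctr_pos hT 0) (ctr_pos hT 1) (ctr_pos hT 2)
  change (1 - (growth T)⁻¹) * size T ≤ _ at h
  linarith [sq_sub_norm_ctr_le hT 0 1, sq_sub_norm_ctr_le hT 1 2, sq_sub_norm_ctr_le hT 2 0]

/-- The vertices of `step T` relative to the centroid of `T`, up to a translation. -/
def permuted (T : Triple) (i : Fin 3) : Plane := ratio T i • ctr T i

/-- One third of the sum of the `permuted` vectors. -/
def shift (T : Triple) : Plane := (1 / 3 : ℝ) • (permuted T 0 + permuted T 1 + permuted T 2)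

lemma step_eq (T : Triple) (i : Fin 3) :
    step T i = centroid T + (permuted T i - shift T) := by
  have h : ∀ i, T i - centroid T = ctr T i := fun _ => rfl
  simp only [step, shift, permuted, h]
  fin_cases i
  · simp only [Fin.zero_eta, show (0 : Fin 3) + 1 = 1 from rfl, show (0 : Fin 3) - 1 = 2 from rfl]
    module
  · simp only [Fin.mk_one, show (1 : Fin 3) + 1 = 2 from rfl, show (1 : Fin 3) - 1 = 0 from rfl]
    module
  · simp only [Fin.reduceFinMk, show (2 : Fin 3) + 1 = 0 from rfl,
      show (2 : Fin 3) - 1 = 1 from rfl]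
    module

lemma permuted_sub_shift_sum (T : Triple) : (permuted T 0 - shift T) + (permuted T 1 - shift T) +
    (permuted T 2 - shift T) = 0 := by
  unfold shift
  module

lemma centroid_step (T : Triple) : centroid (step T) = centroid T :=
  centroid_eq_of_add_ctr (y := fun i => permuted T i - shift T) (permuted_sub_shift_sum T)
    (step_eq T)

lemma ctr_step (T : Triple) (i : Fin 3) : ctr (step T) i = permuted T i - shift T :=
  ctr_eq_of_add_ctr (y := fun i => permuted T i - shift T) (permuted_sub_shift_sum T)
    (step_eq T) i

lemma norm_permuted {T : Triple} (hT : signedArea T ≠ 0) (i : Fin 3) :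
    ‖permuted T i‖ = ‖ctr T (i - 1)‖ := by
  have h := (ctr_pos hT i).ne'
  rw [permuted, norm_smul, ratio, ← ctr, ← ctr, Real.norm_of_nonneg (by positivity)]
  field_simp

lemma size_step_le {T : Triple} (hT : signedArea T ≠ 0) : size (step T) ≤ size T := by
  have h0 := norm_permuted hT 0
  have h1 := norm_permuted hT 1
  have h2 := norm_permuted hT 2
  rw [show (0 : Fin 3) - 1 = 2 from rfl] at h0
  rw [show (1 : Fin 3) - 1 = 0 from rfl] at h1
  rw [show (2 : Fin 3) - 1 = 1 from rfl] at h2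
  have key : size (step T) = ‖permuted T 0‖ ^ 2 + ‖permuted T 1‖ ^ 2 + ‖permuted T 2‖ ^ 2
      - 3 * ‖shift T‖ ^ 2 := by
    simp only [size, ctr_step, norm_sq_plane, shift, PiLp.add_apply, PiLp.sub_apply,
      PiLp.smul_apply, smul_eq_mul]
    ring
  rw [key, h0, h1, h2, size]
  nlinarith [sq_nonneg ‖shift T‖]

/-- Because the centred vectors sum to zero, their three cyclic cross products are equal. Scaling
the vectors by the ratios multiplies these by `rᵢ rᵢ₊₁`, and translation by `shift` does not affect
the area. -/
lemma signedArea_step {T : Triple} (hT : signedArea T ≠ 0) :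
    signedArea (step T) = growth T * signedArea T := by
  have a0 := (ctr_pos hT 0).ne'
  have a1 := (ctr_pos hT 1).ne'
  have a2 := (ctr_pos hT 2).ne'
  have h2 := ctr_two T
  have r0 : ratio T 0 = ‖ctr T 2‖ / ‖ctr T 0‖ := rfl
  have r1 : ratio T 1 = ‖ctr T 0‖ / ‖ctr T 1‖ := rfl
  have r2 : ratio T 2 = ‖ctr T 1‖ / ‖ctr T 2‖ := rfl
  have hg : growth T = (ratio T 0 * ratio T 1 + ratio T 1 * ratio T 2 +
      ratio T 2 * ratio T 0) / 3 := by
    rw [r0, r1, r2, growth, meanQuotient]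
    field_simp
    ring
  rw [hg, signedArea_eq, signedArea_eq]
  simp only [ctr_step, shift, permuted, PiLp.add_apply, PiLp.sub_apply,
      PiLp.smul_apply, smul_eq_mul, h2, PiLp.neg_apply]
  ring

lemma area_step {T : Triple} (hT : signedArea T ≠ 0) : area (step T) = growth T * area T := by
  rw [area, signedArea_step hT, abs_mul, abs_of_pos (growth_pos hT), area]

lemma areaFactor_sq {T : Triple} (hT : signedArea T ≠ 0) : areaFactor T ^ 2 = (growth T)⁻¹ := by
  have hg := growth_pos hT
  have ha : 0 < area T := abs_pos.2 hT
  rw [areaFactor, area_step hT, Real.sq_sqrt (by positivity)]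
  field_simp

lemma areaFactor_pos {T : Triple} (hT : signedArea T ≠ 0) : 0 < areaFactor T := by
  have h := areaFactor_sq hT
  have hg := inv_pos.2 (growth_pos hT)
  refine lt_of_le_of_ne (Real.sqrt_nonneg _) fun h0 => ?_
  rw [← h, ← h0] at hg
  simp at hg

lemma areaFactor_le_one {T : Triple} (hT : signedArea T ≠ 0) : areaFactor T ≤ 1 := by
  have h := areaFactor_sq hT
  have := inv_le_one_of_one_le₀ (one_le_growth hT)
  exact (sq_le_one_iff₀ (areaFactor_pos hT).le).1 (h ▸ this)

/-! ### The rescaled transformations -/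

/-- `step T` with its shape rescaled to the area of `T` and its centroid multiplied by `t`. -/
def rescale (t : ℝ) (T : Triple) : Triple := fun i =>
  t • centroid T + areaFactor T • ctr (step T) i

lemma theta_eq (T : Triple) : theta T = rescale 1 T := by
  funext i
  simp [theta, rescale, ctr, centroid_step]

lemma thetaOrigin_eq (T : Triple) : thetaOrigin T = rescale (areaFactor T) T := by
  funext i
  rw [thetaOrigin, rescale, Pi.smul_apply, ← centroid_add_ctr (step T) i, centroid_step, smul_add]

lemma smul_ctr_sum (s : ℝ) (T : Triple) : s • ctr T 0 + s • ctr T 1 + s • ctr T 2 = 0 := by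
  rw [← smul_add, ← smul_add, ctr_sum, smul_zero]

lemma centroid_rescale (t : ℝ) (T : Triple) : centroid (rescale t T) = t • centroid T :=
  centroid_eq_of_add_ctr (y := fun i => areaFactor T • ctr (step T) i)
    (smul_ctr_sum _ _) fun _ => rfl

lemma ctr_rescale (t : ℝ) (T : Triple) (i : Fin 3) :
    ctr (rescale t T) i = areaFactor T • ctr (step T) i :=
  ctr_eq_of_add_ctr (y := fun i => areaFactor T • ctr (step T) i)
    (smul_ctr_sum _ _) (fun _ => rfl) i

variable {T : Triple}

lemma signedArea_rescale (hT : signedArea T ≠ 0) (t : ℝ) :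
    signedArea (rescale t T) = signedArea T := by
  have h1 := areaFactor_sq hT
  have h2 := signedArea_step hT
  have hg := (growth_pos hT).ne'
  rw [signedArea_eq] at h2 ⊢
  simp only [ctr_rescale, PiLp.smul_apply, smul_eq_mul]
  calc _ = areaFactor T ^ 2 * (3 / 2 * (ctr (step T) 0 0 * ctr (step T) 1 1 -
        ctr (step T) 0 1 * ctr (step T) 1 0)) := by ring
    _ = signedArea T := by rw [h1, h2, inv_mul_cancel_left₀ hg]

lemma area_rescale (hT : signedArea T ≠ 0) (t : ℝ) : area (rescale t T) = area T := by
  rw [area, area, signedArea_rescale hT]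

lemma size_rescale_le (hT : signedArea T ≠ 0) (t : ℝ) :
    size (rescale t T) ≤ (growth T)⁻¹ * size T := by
  have h : size (rescale t T) = areaFactor T ^ 2 * size (step T) := by
    simp only [size, ctr_rescale, norm_smul, mul_pow, Real.norm_eq_abs, sq_abs]
    ring
  rw [h, areaFactor_sq hT]
  exact mul_le_mul_of_nonneg_left (size_step_le hT) (inv_pos.2 (growth_pos hT)).le

lemma defect_rescale_le (hT : signedArea T ≠ 0) (t : ℝ) :
    defect (rescale t T) ≤ 15 / 16 * defect T := by
  have h1 := size_rescale_le hT t
  have h2 := defect_le_one_sub_inv_growth hT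
  have h3 : defect (rescale t T) = size (rescale t T) - (size T - defect T) := by
    rw [defect, area_rescale hT, defect]
    ring
  linarith

/-- The scale invariant version of `defect`. -/
def relDefect (T : Triple) : ℝ := defect T / size T

lemma relDefect_nonneg (T : Triple) : 0 ≤ relDefect T :=
  div_nonneg (defect_nonneg T) (size_nonneg T)

lemma relDefect_le_one (T : Triple) : relDefect T ≤ 1 :=
  div_le_one_of_le₀ (defect_le_size T) (size_nonneg T)

lemma relDefect_eq (hT : signedArea T ≠ 0) :
    relDefect T = 1 - 4 / √3 * area T / size T := by
  rw [relDefect, defect, sub_div, div_self (size_pos hT).ne']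

/-- `size` may decrease, so the contraction of `defect` does not pass directly to the quotient. The
factor `areaFactor T ^ 2 = (growth T)⁻¹` compensates, and it is available because rescaling about
the origin shrinks the centroid by `areaFactor T`. -/
lemma areaFactor_sq_mul_relDefect_rescale_le (hT : signedArea T ≠ 0) (t : ℝ) :
    areaFactor T ^ 2 * relDefect (rescale t T) ≤ 15 / 16 * relDefect T := by
  have hT' : signedArea (rescale t T) ≠ 0 := by rwa [signedArea_rescale hT]
  have hg := growth_pos hT
  have hS := size_pos hT
  have hS' := size_pos hT'
  have h1 := size_rescale_le hT t
  have hA : 0 ≤ 4 / √3 * area T := mul_nonneg (by positivity) (area_nonneg T)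
  have h2 : relDefect T ≤ 16 * (1 - (growth T)⁻¹) := by
    rw [relDefect, div_le_iff₀ hS, mul_assoc]
    exact defect_le_one_sub_inv_growth hT
  have h3 : 4 / √3 * area T / size T ≤ (growth T)⁻¹ * (4 / √3 * area T / size (rescale t T)) := by
    rw [mul_div_assoc', div_le_div_iff₀ hS hS']
    nlinarith [mul_le_mul_of_nonneg_left h1 hA]
  rw [areaFactor_sq hT, relDefect_eq hT', area_rescale hT, mul_sub, mul_one]
  have h4 := relDefect_eq hT
  linarith

/-! ### Bounds for the displacement in one application -/

lemma one_sub_areaFactor_le (hT : signedArea T ≠ 0) :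
    1 - areaFactor T ≤ 1 - (growth T)⁻¹ := by
  rw [← areaFactor_sq hT]
  nlinarith [areaFactor_pos hT, areaFactor_le_one hT]

lemma one_sub_areaFactor_le_sqrt (hT : signedArea T ≠ 0) :
    1 - areaFactor T ≤ 4 * √(relDefect T) := by
  have h0 : 0 ≤ 1 - areaFactor T := sub_nonneg.2 (areaFactor_le_one hT)
  have h1 := one_sub_areaFactor_le hT
  have h2 : 1 - (growth T)⁻¹ ≤ 12 * relDefect T := by
    rw [relDefect, mul_div_assoc', le_div_iff₀ (size_pos hT)]
    exact one_sub_inv_growth_le_defect hT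
  refine abs_le_of_sq_le_sq' ?_ (by positivity) |>.2
  rw [mul_pow, Real.sq_sqrt (relDefect_nonneg T)]
  -- `0 ≤ 1 - s ≤ 1` and `1 - s ≤ 12 δ` give `(1 - s)² ≤ 12 δ ≤ 16 δ`.
  nlinarith [areaFactor_pos hT, relDefect_nonneg T]

lemma norm_ctr_le_sqrt_size (T : Triple) (i : Fin 3) : ‖ctr T i‖ ≤ √(size T) := by
  refine Real.le_sqrt_of_sq_le ?_
  unfold size
  fin_cases i <;> simp only [Fin.zero_eta, Fin.mk_one, Fin.reduceFinMk] <;>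
    nlinarith [sq_nonneg ‖ctr T 0‖, sq_nonneg ‖ctr T 1‖, sq_nonneg ‖ctr T 2‖]

lemma sqrt_relDefect_mul_sqrt_size (hT : signedArea T ≠ 0) :
    √(relDefect T) * √(size T) = √(defect T) := by
  rw [← Real.sqrt_mul (relDefect_nonneg T), relDefect, div_mul_cancel₀ _ (size_pos hT).ne']

lemma norm_permuted_sub_ctr_le (hT : signedArea T ≠ 0) (i : Fin 3) :
    ‖permuted T i - ctr T i‖ ≤ 2 * √(defect T) := by
  have ha := ctr_pos hT i
  have h : ‖permuted T i - ctr T i‖ = |‖ctr T (i - 1)‖ - ‖ctr T i‖| := by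
    have h1 : permuted T i - ctr T i = (ratio T i - 1) • ctr T i := by
      rw [permuted, sub_smul, one_smul]
    have h2 : ‖ctr T (i - 1)‖ - ‖ctr T i‖ = (ratio T i - 1) * ‖ctr T i‖ := by
      rw [ratio, ← ctr, ← ctr]
      field_simp
    rw [h1, h2, norm_smul, Real.norm_eq_abs, abs_mul, abs_of_pos ha]
  rw [h]
  refine abs_le_of_sq_le_sq ?_ (by positivity)
  rw [mul_pow, Real.sq_sqrt (defect_nonneg T)]
  linarith [sq_sub_norm_ctr_le hT (i - 1) i, defect_nonneg T]

/-- As the centred vectors sum to zero, `shift` is the mean of the differences `permuted T i - ctr T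
i`. -/
lemma norm_shift_le (hT : signedArea T ≠ 0) : ‖shift T‖ ≤ 2 * √(defect T) := by
  have h : shift T = (1 / 3 : ℝ) • ((permuted T 0 - ctr T 0) + (permuted T 1 - ctr T 1) +
      (permuted T 2 - ctr T 2)) := by
    rw [shift, ctr_two]
    module
  rw [h, norm_smul, Real.norm_of_nonneg (by norm_num)]
  have h3 := norm_add₃_le (a := permuted T 0 - ctr T 0) (b := permuted T 1 - ctr T 1)
    (c := permuted T 2 - ctr T 2)
  linarith [norm_permuted_sub_ctr_le hT 0, norm_permuted_sub_ctr_le hT 1,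
    norm_permuted_sub_ctr_le hT 2]

lemma norm_ctr_rescale_sub_le (hT : signedArea T ≠ 0) (t : ℝ) (i : Fin 3) :
    ‖ctr (rescale t T) i - ctr T i‖ ≤ 8 * √(defect T) := by
  have h : ctr (rescale t T) i - ctr T i =
      areaFactor T • ((permuted T i - ctr T i) - shift T) - (1 - areaFactor T) • ctr T i := by
    rw [ctr_rescale, ctr_step]
    module
  have hs := areaFactor_le_one hT
  have h1 : ‖(permuted T i - ctr T i) - shift T‖ ≤ 4 * √(defect T) :=
    (norm_sub_le _ _).trans (by linarith [norm_permuted_sub_ctr_le hT i, norm_shift_le hT])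
  have h2 : (1 - areaFactor T) * ‖ctr T i‖ ≤ 4 * √(defect T) := by
    rw [← sqrt_relDefect_mul_sqrt_size hT, ← mul_assoc]
    exact mul_le_mul (one_sub_areaFactor_le_sqrt hT) (norm_ctr_le_sqrt_size T i)
      (norm_nonneg _) (by positivity)
  rw [h]
  refine (norm_sub_le _ _).trans ?_
  rw [norm_smul, norm_smul, Real.norm_of_nonneg (areaFactor_pos hT).le,
    Real.norm_of_nonneg (sub_nonneg.2 hs)]
  have h3 := mul_le_of_le_one_left (norm_nonneg ((permuted T i - ctr T i) - shift T)) hs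
  linarith

lemma norm_rescale_sub_le (hT : signedArea T ≠ 0) {t : ℝ} (ht : t ≤ 1) :
    ‖rescale t T - T‖ ≤ 8 * √(defect T) + (1 - t) * ‖centroid T‖ := by
  have h0 : 0 ≤ (1 - t) * ‖centroid T‖ := mul_nonneg (sub_nonneg.2 ht) (norm_nonneg _)
  refine (pi_norm_le_iff_of_nonneg (by positivity)).2 fun i => ?_
  have h : (rescale t T - T) i =
      (ctr (rescale t T) i - ctr T i) - (1 - t) • centroid T := by
    rw [Pi.sub_apply, ← centroid_add_ctr T i, ← centroid_add_ctr (rescale t T) i,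
      centroid_rescale]
    module
  rw [h]
  refine (norm_sub_le _ _).trans ?_
  rw [norm_smul, Real.norm_of_nonneg (sub_nonneg.2 ht)]
  linarith [norm_ctr_rescale_sub_le hT t i]

lemma norm_centroid_le (T : Triple) : ‖centroid T‖ ≤ ‖T‖ := by
  rw [centroid, norm_smul, Real.norm_of_nonneg (by norm_num)]
  have h3 := norm_add₃_le (a := T 0) (b := T 1) (c := T 2)
  linarith [norm_le_pi_norm T 0, norm_le_pi_norm T 1, norm_le_pi_norm T 2]

lemma size_le (T : Triple) : size T ≤ 3 * ‖T‖ ^ 2 := by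
  have h : size T ≤ ‖T 0‖ ^ 2 + ‖T 1‖ ^ 2 + ‖T 2‖ ^ 2 := by
    simp only [size, norm_sq_plane, ctr_apply]
    nlinarith [sq_nonneg (T 0 0 + T 1 0 + T 2 0), sq_nonneg (T 0 1 + T 1 1 + T 2 1)]
  have hi : ∀ i, ‖T i‖ ^ 2 ≤ ‖T‖ ^ 2 := fun i =>
    pow_le_pow_left₀ (norm_nonneg _) (norm_le_pi_norm T i) 2
  linarith [hi 0, hi 1, hi 2]

lemma sqrt_defect_le_norm (T : Triple) : √(defect T) ≤ 2 * ‖T‖ := by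
  refine (Real.sqrt_le_sqrt (defect_le_size T)).trans (Real.sqrt_le_iff.2 ⟨by positivity, ?_⟩)
  nlinarith [size_le T, sq_nonneg ‖T‖]

lemma sqrt_le_of_le_mul_sq {x y q : ℝ} (hq : 0 ≤ q) (h : x ≤ q ^ 2 * y) : √x ≤ q * √y := by
  calc √x ≤ √(q ^ 2 * y) := Real.sqrt_le_sqrt h
    _ = q * √y := by rw [Real.sqrt_mul (sq_nonneg q), Real.sqrt_sq hq]

/-- The contraction rate. -/
def rate : ℝ := √(15 / 16)

lemma rate_sq : rate ^ 2 = 15 / 16 := Real.sq_sqrt (by norm_num)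

lemma rate_pos : 0 < rate := Real.sqrt_pos.2 (by norm_num)

lemma rate_lt_one : rate < 1 := (Real.sqrt_lt' one_pos).2 (by norm_num)

lemma sqrt_defect_rescale_le (hT : signedArea T ≠ 0) (t : ℝ) :
    √(defect (rescale t T)) ≤ rate * √(defect T) :=
  sqrt_le_of_le_mul_sq rate_pos.le (rate_sq.symm ▸ defect_rescale_le hT t)

lemma areaFactor_mul_sqrt_relDefect_rescale_le (hT : signedArea T ≠ 0) (t : ℝ) :
    areaFactor T * √(relDefect (rescale t T)) ≤ rate * √(relDefect T) := by
  have h := areaFactor_sq_mul_relDefect_rescale_le hT t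
  rw [← rate_sq] at h
  replace h := sqrt_le_of_le_mul_sq rate_pos.le h
  rwa [Real.sqrt_mul (sq_nonneg _), Real.sqrt_sq (areaFactor_pos hT).le] at h

/-- The facts about the two transformations from which their dynamics is derived: a nonnegative
function `ρ` dominates the displacement and is contracted. -/
structure IsContractedBy (f : Triple → Triple) (ρ : Triple → ℝ) : Prop where
  signedArea_map : ∀ T, signedArea T ≠ 0 → signedArea (f T) = signedArea T
  sqrt_defect_map : ∀ T, signedArea T ≠ 0 → √(defect (f T)) ≤ rate * √(defect T)
  displacement : ∀ T, signedArea T ≠ 0 → ‖f T - T‖ ≤ 8 * ρ T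
  contract : ∀ T, signedArea T ≠ 0 → ρ (f T) ≤ rate * ρ T
  le_norm : ∀ T, ρ T ≤ 3 * ‖T‖
  eq_zero : ∀ T, defect T = 0 → ρ T = 0

lemma isContractedBy_theta : IsContractedBy theta fun T => √(defect T) where
  signedArea_map T hT := by rw [theta_eq, signedArea_rescale hT]
  sqrt_defect_map T hT := by rw [theta_eq]; exact sqrt_defect_rescale_le hT 1
  displacement T hT := by
    rw [theta_eq]
    simpa using norm_rescale_sub_le hT (le_refl 1)
  contract T hT := by rw [theta_eq]; exact sqrt_defect_rescale_le hT 1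
  le_norm T := (sqrt_defect_le_norm T).trans (by linarith [norm_nonneg T])
  eq_zero T h := by simp [h]

/-- The centroid moves by `(1 - areaFactor T) * ‖centroid T‖`, which the second term of the
potential dominates. -/
lemma isContractedBy_thetaOrigin : IsContractedBy thetaOrigin
    fun T => √(defect T) + ‖centroid T‖ * √(relDefect T) where
  signedArea_map T hT := by rw [thetaOrigin_eq, signedArea_rescale hT]
  sqrt_defect_map T hT := by rw [thetaOrigin_eq]; exact sqrt_defect_rescale_le hT _
  displacement T hT := by
    rw [thetaOrigin_eq]
    have h1 := norm_rescale_sub_le hT (areaFactor_le_one hT)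
    have h2 := mul_le_mul_of_nonneg_right (one_sub_areaFactor_le_sqrt hT)
      (norm_nonneg (centroid T))
    have h3 : 0 ≤ ‖centroid T‖ * √(relDefect T) := by positivity
    linarith
  contract T hT := by
    rw [thetaOrigin_eq, centroid_rescale, norm_smul, Real.norm_of_nonneg (areaFactor_pos hT).le]
    have h1 := sqrt_defect_rescale_le hT (areaFactor T)
    have h2 := mul_le_mul_of_nonneg_left
      (areaFactor_mul_sqrt_relDefect_rescale_le hT (areaFactor T)) (norm_nonneg (centroid T))
    linarith
  le_norm T := by
    have h1 := mul_le_mul (norm_centroid_le T) (Real.sqrt_le_one.2 (relDefect_le_one T))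
      (Real.sqrt_nonneg _) (norm_nonneg T)
    linarith [sqrt_defect_le_norm T]
  eq_zero T h := by simp [relDefect, h]

/-! ### Equilateral triangles and similarity -/

lemma mem_triangles_iff {T : Triple} : T ∈ triangles ↔ signedArea T ≠ 0 := by
  rw [triangles, Set.mem_ofPred_eq, not_iff_not,
    collinear_iff_of_mem (Set.mem_range_self (f := T) 0)]
  constructor
  · rintro ⟨v, hv⟩
    obtain ⟨r, hr⟩ := hv (T 1) (Set.mem_range_self 1)
    obtain ⟨s, hs⟩ := hv (T 2) (Set.mem_range_self 2)
    rw [signedArea, hr, hs]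
    simp
    ring
  · intro h
    have h' : (T 1 0 - T 0 0) * (T 2 1 - T 0 1) = (T 1 1 - T 0 1) * (T 2 0 - T 0 0) := by
      unfold signedArea at h
      linarith
    suffices H : ∃ v : Plane, (∃ r : ℝ, T 1 = r • v + T 0) ∧ ∃ r : ℝ, T 2 = r • v + T 0 by
      obtain ⟨v, h1, h2⟩ := H
      refine ⟨v, ?_⟩
      rintro _ ⟨i, rfl⟩
      fin_cases i
      · exact ⟨0, by simp⟩
      · exact h1
      · exact h2
    by_cases hu : T 1 = T 0
    · exact ⟨T 2 - T 0, ⟨0, by simp [hu]⟩, 1, by simp⟩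
    · have hne : 0 < (T 1 0 - T 0 0) ^ 2 + (T 1 1 - T 0 1) ^ 2 := by
        have := norm_sq_plane (T 1 - T 0)
        simp only [PiLp.sub_apply] at this
        rw [← this]
        exact pow_pos (norm_pos_iff.2 (sub_ne_zero.2 hu)) 2
      -- The coefficient is that of the orthogonal projection of `T 2 - T 0` onto `T 1 - T 0`.
      refine ⟨T 1 - T 0, ⟨1, by simp⟩, ((T 1 0 - T 0 0) * (T 2 0 - T 0 0) +
        (T 1 1 - T 0 1) * (T 2 1 - T 0 1)) / ((T 1 0 - T 0 0) ^ 2 + (T 1 1 - T 0 1) ^ 2), ?_⟩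
      ext j
      simp only [PiLp.add_apply, PiLp.smul_apply, PiLp.sub_apply, smul_eq_mul]
      rw [← sub_eq_iff_eq_add, div_mul_eq_mul_div, eq_div_iff hne.ne']
      fin_cases j <;> simp only [Fin.zero_eta, Fin.mk_one]
      · linear_combination (-(T 1 1 - T 0 1)) * h'
      · linear_combination (T 1 0 - T 0 0) * h'

lemma mem_trianglesOriented_iff {E T : Triple} :
    T ∈ trianglesOriented E ↔ 0 < signedArea E * signedArea T := by
  rw [trianglesOriented, Set.mem_ofPred_eq, mem_triangles_iff]
  exact ⟨And.right, fun h => ⟨right_ne_zero_of_mul h.ne', h⟩⟩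

lemma defect_eq_zero_of_isEquilateral {T : Triple} (h : IsEquilateral T) : defect T = 0 := by
  have h1 : ‖T 0 - T 1‖ ^ 2 = ‖T 1 - T 2‖ ^ 2 := by
    rw [← dist_eq_norm, ← dist_eq_norm, h.1]
  have h2 : ‖T 1 - T 2‖ ^ 2 = ‖T 2 - T 0‖ ^ 2 := by
    rw [← dist_eq_norm, ← dist_eq_norm, h.2]
  simp only [norm_sq_plane, PiLp.sub_apply] at h1 h2
  have e1 : ‖ctr T 0‖ ^ 2 = ‖ctr T 1‖ ^ 2 := by
    simp only [norm_sq_plane, ctr_apply]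
    linear_combination (-1 / 3 : ℝ) * h2
  have e2 : ‖ctr T 1‖ ^ 2 = ‖ctr T 2‖ ^ 2 := by
    simp only [norm_sq_plane, ctr_apply]
    linear_combination (1 / 3 : ℝ) * (h1 + h2)
  have h3 := size_sq_sub T
  rw [e1, e2, sub_self] at h3
  have h4 : size T = 4 / √3 * area T :=
    (sq_eq_sq₀ (size_nonneg T) (mul_nonneg (by positivity) (area_nonneg T))).1 (by linarith)
  rw [defect, h4, sub_self]

lemma toEuclideanLin_apply_eq (A : Matrix (Fin 2) (Fin 2) ℝ) (x : Plane) (j : Fin 2) :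
    Matrix.toEuclideanLin A x j = A j 0 * x 0 + A j 1 * x 1 := by
  simp [Matrix.toEuclideanLin, Matrix.mulVec, dotProduct, Fin.sum_univ_two]

lemma specialOrthogonal_entries {A : Matrix (Fin 2) (Fin 2) ℝ}
    (hA : A ∈ Matrix.specialOrthogonalGroup (Fin 2) ℝ) :
    A 1 1 = A 0 0 ∧ A 1 0 = -A 0 1 ∧ A 0 0 ^ 2 + A 0 1 ^ 2 = 1 := by
  rw [Matrix.mem_specialOrthogonalGroup_iff, Matrix.mem_orthogonalGroup_iff,
    Matrix.det_fin_two] at hA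
  obtain ⟨h, hd⟩ := hA
  have h0 := congrFun (congrFun h 0) 0
  have h1 := congrFun (congrFun h 1) 1
  simp [Matrix.mul_apply, Fin.sum_univ_two] at h0 h1
  -- The left side is the trace of `A Aᵀ` minus twice the determinant, that is `2 - 2`.
  have h2 : (A 1 1 - A 0 0) ^ 2 + (A 1 0 + A 0 1) ^ 2 = 0 := by nlinarith
  refine ⟨?_, ?_, by linarith⟩
  · nlinarith [sq_nonneg (A 1 1 - A 0 0), sq_nonneg (A 1 0 + A 0 1)]
  · nlinarith [sq_nonneg (A 1 1 - A 0 0), sq_nonneg (A 1 0 + A 0 1)]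

lemma rotation_mem {p q : ℝ} (h : p ^ 2 + q ^ 2 = 1) :
    !![p, -q; q, p] ∈ Matrix.specialOrthogonalGroup (Fin 2) ℝ := by
  rw [Matrix.mem_specialOrthogonalGroup_iff, Matrix.mem_orthogonalGroup_iff]
  constructor
  · ext i j
    fin_cases i <;> fin_cases j <;> simp [Matrix.mul_apply, Fin.sum_univ_two] <;> linarith
  · rw [Matrix.det_fin_two_of]
    linarith

lemma signedArea_size_of_similar {S T : Triple} (h : Similar S T) :
    ∃ a > 0, signedArea T = a ^ 2 * signedArea S ∧ size T = a ^ 2 * size S := by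
  obtain ⟨A, hA, v, a, ha, h⟩ := h
  obtain ⟨h1, h2, h3⟩ := specialOrthogonal_entries hA
  have hT : ∀ i j, T i j = a * (A j 0 * S i 0 + A j 1 * S i 1 + v j) := fun i j => by
    rw [← h i, PiLp.smul_apply, PiLp.add_apply, toEuclideanLin_apply_eq, smul_eq_mul]
  refine ⟨a, ha, ?_, ?_⟩
  · simp only [signedArea, hT, h1, h2]
    linear_combination (a ^ 2 * ((S 1 0 - S 0 0) * (S 2 1 - S 0 1) -
      (S 1 1 - S 0 1) * (S 2 0 - S 0 0)) / 2) * h3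
  · have hy : ∀ i, ‖ctr T i‖ ^ 2 = a ^ 2 * ‖ctr S i‖ ^ 2 := fun i => by
      simp only [norm_sq_plane, ctr_apply, hT, h1, h2]
      linear_combination (a ^ 2 * ((S i 0 - (S 0 0 + S 1 0 + S 2 0) / 3) ^ 2 +
        (S i 1 - (S 0 1 + S 1 1 + S 2 1) / 3) ^ 2)) * h3
    rw [size, hy, hy, hy, size]
    ring

lemma skew_eq_zero {σ : ℝ} (hσ : σ ^ 2 = 1) {T : Triple} (hT : area T = σ * signedArea T)
    (h : defect T = 0) : skew σ T = 0 := by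
  have h1 := size_sub_eq_norm_skew_sq hσ T
  rw [← hT, ← defect, h] at h1
  have h2 : ‖skew σ T‖ ^ 2 = 0 := by linarith
  exact norm_eq_zero.1 (pow_eq_zero_iff two_ne_zero |>.1 h2)

lemma exists_common_sign {S T : Triple} (h : 0 < signedArea S * signedArea T) :
    ∃ σ : ℝ, σ ^ 2 = 1 ∧ area S = σ * signedArea S ∧ area T = σ * signedArea T := by
  rcases mul_pos_iff.1 h with ⟨h1, h2⟩ | ⟨h1, h2⟩
  · exact ⟨1, by norm_num, by simp [area, abs_of_pos h1], by simp [area, abs_of_pos h2]⟩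
  · exact ⟨-1, by norm_num, by simp [area, abs_of_neg h1], by simp [area, abs_of_neg h2]⟩

lemma skew_apply_zero (σ : ℝ) (T : Triple) :
    skew σ T 0 = ctr T 1 0 + 1 / 2 * ctr T 0 0 + σ * √3 / 2 * ctr T 0 1 := by
  simp [skew]

lemma skew_apply_one (σ : ℝ) (T : Triple) :
    skew σ T 1 = ctr T 1 1 + 1 / 2 * ctr T 0 1 - σ * √3 / 2 * ctr T 0 0 := by
  simp [skew]

lemma similar_of_defect_eq_zero {S T : Triple} (h : 0 < signedArea S * signedArea T)
    (hS : defect S = 0) (hT : defect T = 0) : Similar S T := by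
  obtain ⟨σ, hσ, h1, h2⟩ := exists_common_sign h
  have s1 := skew_eq_zero hσ h1 hS
  have s2 := skew_eq_zero hσ h2 hT
  have s10 : skew σ S 0 = 0 := by rw [s1]; rfl
  have s11 : skew σ S 1 = 0 := by rw [s1]; rfl
  have s20 : skew σ T 0 = 0 := by rw [s2]; rfl
  have s21 : skew σ T 1 = 0 := by rw [s2]; rfl
  rw [skew_apply_zero] at s10 s20
  rw [skew_apply_one] at s11 s21
  have hS0 := pow_pos (ctr_pos (left_ne_zero_of_mul h.ne') 0) 2
  have hT0 := pow_pos (ctr_pos (right_ne_zero_of_mul h.ne') 0) 2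
  rw [norm_sq_plane] at hS0 hT0
  -- `p + iq` is the complex quotient of the first centred vertices of `T` and `S`. Since `skew`
  -- vanishes on both, multiplication by it also matches the other vertices; its modulus is the
  -- scaling and its argument the rotation.
  obtain ⟨p, hp⟩ : ∃ p, p = (ctr S 0 0 * ctr T 0 0 + ctr S 0 1 * ctr T 0 1) /
    (ctr S 0 0 ^ 2 + ctr S 0 1 ^ 2) := ⟨_, rfl⟩
  obtain ⟨q, hq⟩ : ∃ q, q = (ctr S 0 0 * ctr T 0 1 - ctr S 0 1 * ctr T 0 0) /
    (ctr S 0 0 ^ 2 + ctr S 0 1 ^ 2) := ⟨_, rfl⟩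
  have e00 : ctr T 0 0 = p * ctr S 0 0 - q * ctr S 0 1 := by
    rw [hp, hq]
    field_simp
    ring
  have e01 : ctr T 0 1 = q * ctr S 0 0 + p * ctr S 0 1 := by
    rw [hp, hq]
    field_simp
    ring
  have e10 : ctr T 1 0 = p * ctr S 1 0 - q * ctr S 1 1 := by
    linear_combination s20 - p * s10 + q * s11 - 1 / 2 * e00 - σ * √3 / 2 * e01
  have e11 : ctr T 1 1 = q * ctr S 1 0 + p * ctr S 1 1 := by
    linear_combination s21 - q * s10 - p * s11 - 1 / 2 * e01 + σ * √3 / 2 * e00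
  have hpq : 0 < p ^ 2 + q ^ 2 := by
    rw [e00, e01] at hT0
    by_contra! hneg
    nlinarith [mul_nonneg (neg_nonneg.2 hneg) hS0.le]
  set a := √(p ^ 2 + q ^ 2) with ha
  have ha0 : 0 < a := Real.sqrt_pos.2 hpq
  have ha2 : a ^ 2 = p ^ 2 + q ^ 2 := Real.sq_sqrt hpq.le
  have key : ∀ i, ctr T i 0 = p * ctr S i 0 - q * ctr S i 1 ∧
      ctr T i 1 = q * ctr S i 0 + p * ctr S i 1 := by
    intro i
    fin_cases i
    · exact ⟨e00, e01⟩
    · exact ⟨e10, e11⟩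
    · simp only [Fin.reduceFinMk, ctr_two, PiLp.neg_apply, PiLp.add_apply]
      exact ⟨by linear_combination -e00 - e10, by linear_combination -e01 - e11⟩
  refine ⟨!![p / a, -(q / a); q / a, p / a], rotation_mem ?_, !₂[
    (centroid T 0 - (p * centroid S 0 - q * centroid S 1)) / a,
    (centroid T 1 - (q * centroid S 0 + p * centroid S 1)) / a], a, ha0, fun i => ?_⟩
  · rw [div_pow, div_pow, ← add_div, ha2, div_self hpq.ne']
  · have hSi := fun j : Fin 2 => congrArg (fun v : Plane => v j) (centroid_add_ctr S i)
    have hTi := fun j : Fin 2 => congrArg (fun v : Plane => v j) (centroid_add_ctr T i)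
    simp only [PiLp.add_apply] at hSi hTi
    obtain ⟨k0, k1⟩ := key i
    ext j
    rw [PiLp.smul_apply, PiLp.add_apply, toEuclideanLin_apply_eq, smul_eq_mul, ← hTi, ← hSi,
      ← hSi]
    fin_cases j
    · simp
      rw [k0]
      field_simp
      ring
    · simp
      rw [k1]
      field_simp
      ring

lemma mem_similarityClass_iff {E T : Triple} (hE : E ∈ triangles) (hEq : IsEquilateral E) :
    T ∈ similarityClass E ↔ 0 < signedArea E * signedArea T ∧ defect T = 0 := by
  have hE0 := defect_eq_zero_of_isEquilateral hEq
  constructor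
  · intro h
    obtain ⟨a, ha, h1, h2⟩ := signedArea_size_of_similar h
    refine ⟨?_, ?_⟩
    · have := mul_self_pos.2 (mem_triangles_iff.1 hE)
      rw [h1]
      nlinarith [mul_pos (pow_pos ha 2) this]
    · rw [defect, area, h1, abs_mul, abs_of_pos (pow_pos ha 2), h2, ← area]
      rw [defect] at hE0
      linear_combination a ^ 2 * hE0
  · rintro ⟨h1, h2⟩
    exact similar_of_defect_eq_zero h1 hE0 h2

/-! ### Comparison of the defect with the distance to equilateral triples -/

lemma skew_sub (σ : ℝ) (S T : Triple) : skew σ (S - T) = skew σ S - skew σ T := by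
  have h : ∀ i j, (S - T) i j = S i j - T i j := fun _ _ => rfl
  ext j
  fin_cases j
  · change skew σ (S - T) 0 = skew σ S 0 - skew σ T 0
    simp only [skew_apply_zero, ctr_apply, h]
    ring
  · change skew σ (S - T) 1 = skew σ S 1 - skew σ T 1
    simp only [skew_apply_one, ctr_apply, h]
    ring

/-- `skew` is linear and vanishes at `L`, so `defect T` is `2‖skew σ (T - L)‖²`, which is at most `2
* size (T - L) ≤ 6‖T - L‖²`. -/
lemma sqrt_defect_le_norm_sub {L T : Triple} (h : 0 < signedArea L * signedArea T)
    (hL : defect L = 0) : √(defect T) ≤ 3 * ‖T - L‖ := by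
  obtain ⟨σ, hσ, h1, h2⟩ := exists_common_sign h
  have h3 : skew σ (T - L) = skew σ T := by rw [skew_sub, skew_eq_zero hσ h1 hL, sub_zero]
  have h4 : defect T = 2 * ‖skew σ (T - L)‖ ^ 2 := by
    rw [h3, ← size_sub_eq_norm_skew_sq hσ, ← h2, defect]
  have h5 : -(σ * signedArea (T - L)) ≤ area (T - L) := by
    refine (neg_le_abs _).trans (le_of_eq ?_)
    rw [abs_mul, (pow_eq_one_iff_of_nonneg (abs_nonneg σ) two_ne_zero).1 (by rw [sq_abs, hσ]), one_mul, area]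
  have h6 : 4 / √3 * -(σ * signedArea (T - L)) ≤ 4 / √3 * area (T - L) :=
    mul_le_mul_of_nonneg_left h5 (by positivity)
  refine Real.sqrt_le_iff.2 ⟨by positivity, ?_⟩
  rw [h4, ← size_sub_eq_norm_skew_sq hσ]
  nlinarith [area_le_size (T - L), size_le (T - L), sq_nonneg ‖T - L‖]

lemma continuous_signedArea : Continuous signedArea := by
  unfold signedArea
  fun_prop

lemma continuous_defect : Continuous defect := by
  have h := continuous_signedArea
  unfold defect size area ctr centroid
  fun_prop

/-! ### Convergence -/

section Dynamics

variable {f : Triple → Triple} {ρ : Triple → ℝ} {E T : Triple}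

lemma IsContractedBy.iterate (hf : IsContractedBy f ρ) (hT : signedArea T ≠ 0) (n : ℕ) :
    signedArea (f^[n] T) = signedArea T ∧ √(defect (f^[n] T)) ≤ √(defect T) * rate ^ n ∧
      ρ (f^[n] T) ≤ ρ T * rate ^ n := by
  induction n with
  | zero => simp
  | succ n ih =>
    obtain ⟨h1, h2, h3⟩ := ih
    have hn : signedArea (f^[n] T) ≠ 0 := by rwa [h1]
    rw [Function.iterate_succ_apply']
    refine ⟨(hf.signedArea_map _ hn).trans h1, (hf.sqrt_defect_map _ hn).trans ?_,
      (hf.contract _ hn).trans ?_⟩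
    · calc _ ≤ rate * (√(defect T) * rate ^ n) := mul_le_mul_of_nonneg_left h2 rate_pos.le
        _ = _ := by ring
    · calc _ ≤ rate * (ρ T * rate ^ n) := mul_le_mul_of_nonneg_left h3 rate_pos.le
        _ = _ := by ring

lemma tendsto_mul_rate_pow (c : ℝ) :
    Filter.Tendsto (fun n : ℕ => c * rate ^ n) Filter.atTop (nhds 0) := by
  simpa using (tendsto_pow_atTop_nhds_zero_of_lt_one rate_pos.le rate_lt_one).const_mul c

lemma IsContractedBy.exists_limit (hf : IsContractedBy f ρ) (hE : E ∈ triangles)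
    (hEq : IsEquilateral E) (hT : 0 < signedArea E * signedArea T) :
    ∃ L ∈ similarityClass E, ∀ n : ℕ, ‖f^[n] T - L‖ ≤ 8 * ρ T * rate ^ n / (1 - rate) := by
  have hT0 := right_ne_zero_of_mul hT.ne'
  have hu : ∀ n : ℕ, dist (f^[n] T) (f^[n + 1] T) ≤ 8 * ρ T * rate ^ n := fun n => by
    obtain ⟨h1, -, h3⟩ := hf.iterate hT0 n
    rw [dist_comm, dist_eq_norm, Function.iterate_succ_apply']
    refine (hf.displacement _ (by rwa [h1])).trans ?_
    linarith
  obtain ⟨L, hL⟩ := cauchySeq_tendsto_of_complete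
    (cauchySeq_of_le_geometric rate (8 * ρ T) rate_lt_one hu)
  refine ⟨L, (mem_similarityClass_iff hE hEq).2 ⟨?_, ?_⟩, fun n => ?_⟩
  -- Signed area is constant along the orbit, so the limit cannot degenerate or change orientation.
  · have h1 := (continuous_signedArea.tendsto L).comp hL
    have h2 : signedArea ∘ (fun n => f^[n] T) = fun _ => signedArea T :=
      funext fun n => (hf.iterate hT0 n).1
    rw [h2] at h1
    rwa [← tendsto_nhds_unique h1 tendsto_const_nhds] at hT
  · have h1 := ((Real.continuous_sqrt.comp continuous_defect).tendsto L).comp hL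
    have h2 := le_of_tendsto_of_tendsto' h1 (tendsto_mul_rate_pow (√(defect T)))
      fun n => (hf.iterate hT0 n).2.1
    exact (Real.sqrt_eq_zero (defect_nonneg L)).1 (le_antisymm h2 (Real.sqrt_nonneg _))
  · rw [← dist_eq_norm]
    exact dist_le_of_le_geometric_of_tendsto rate (8 * ρ T) rate_lt_one hu hL n

/-- The distance to the class does not involve the map, so the limit of the `theta`-orbit serves as
a nearby point for both transformations. -/
lemma infDist_le_sqrt_defect (hE : E ∈ triangles) (hEq : IsEquilateral E)
    (hT : 0 < signedArea E * signedArea T) :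
    Metric.infDist T (similarityClass E) ≤ 8 / (1 - rate) * √(defect T) := by
  obtain ⟨L, hL, h⟩ := isContractedBy_theta.exists_limit hE hEq hT
  refine (Metric.infDist_le_dist_of_mem hL).trans ?_
  rw [dist_eq_norm]
  exact (h 0).trans (le_of_eq (by simp; ring))

lemma sqrt_defect_le_infDist (hE : E ∈ triangles) (hEq : IsEquilateral E)
    (hT : 0 < signedArea E * signedArea T) :
    √(defect T) ≤ 3 * Metric.infDist T (similarityClass E) := by
  have hne : (similarityClass E).Nonempty :=
    let ⟨L, hL, _⟩ := isContractedBy_theta.exists_limit hE hEq hT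
    ⟨L, hL⟩
  have h : √(defect T) / 3 ≤ Metric.infDist T (similarityClass E) := by
    refine (Metric.le_infDist hne).2 fun L hL => ?_
    obtain ⟨h1, h2⟩ := (mem_similarityClass_iff hE hEq).1 hL
    have h3 : 0 < signedArea L * signedArea T := by
      have h4 := mul_self_pos.2 (left_ne_zero_of_mul hT.ne')
      by_contra! h5
      nlinarith [mul_pos h1 hT, mul_nonneg h4.le (neg_nonneg.2 h5)]
    have := sqrt_defect_le_norm_sub h3 h2
    rw [dist_eq_norm]
    linarith
  linarith

lemma IsContractedBy.infDist_iterate_le (hf : IsContractedBy f ρ) (hE : E ∈ triangles)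
    (hEq : IsEquilateral E) (hT : 0 < signedArea E * signedArea T) (n : ℕ) :
    Metric.infDist (f^[n] T) (similarityClass E) ≤
      8 / (1 - rate) * (√(defect T) * rate ^ n) := by
  obtain ⟨h1, h2, -⟩ := hf.iterate (right_ne_zero_of_mul hT.ne') n
  refine (infDist_le_sqrt_defect hE hEq (by rwa [h1])).trans ?_
  have := sub_pos.2 rate_lt_one
  gcongr

lemma IsContractedBy.isGlobalAttractor (hf : IsContractedBy f ρ) (hE : E ∈ triangles)
    (hEq : IsEquilateral E) :
    IsGlobalAttractor f (trianglesOriented E) (similarityClass E) := by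
  have hrate := sub_pos.2 rate_lt_one
  have hfix : ∀ T ∈ similarityClass E, f T = T := fun T hT => by
    obtain ⟨h1, h2⟩ := (mem_similarityClass_iff hE hEq).1 hT
    have h3 := hf.displacement T (right_ne_zero_of_mul h1.ne')
    rw [hf.eq_zero T h2, mul_zero] at h3
    exact sub_eq_zero.1 (norm_le_zero_iff.1 h3)
  refine ⟨fun T hT => ?_, ⟨E, ?_⟩, fun T hT => ?_, ?_, ?_, fun ε hε => ?_,
    fun B hBX hB ε hε => ?_⟩
  · rw [mem_trianglesOriented_iff] at hT ⊢
    rwa [hf.signedArea_map T (right_ne_zero_of_mul hT.ne')]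
  · exact (mem_similarityClass_iff hE hEq).2 ⟨mul_self_pos.2 (mem_triangles_iff.1 hE),
      defect_eq_zero_of_isEquilateral hEq⟩
  · exact mem_trianglesOriented_iff.2 ((mem_similarityClass_iff hE hEq).1 hT).1
  · rintro T ⟨h1, h2⟩
    refine (mem_similarityClass_iff hE hEq).2 ⟨mem_trianglesOriented_iff.1 h2, ?_⟩
    have hcl : IsClosed {T : Triple | defect T = 0} := isClosed_eq continuous_defect
      continuous_const
    exact closure_minimal (fun S hS => ((mem_similarityClass_iff hE hEq).1 hS).2) hcl h1
  · rw [Set.image_congr hfix, Set.image_id']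
  -- `24 = 8 * 3` combines the constants of `infDist_iterate_le` and `sqrt_defect_le_infDist`.
  · refine ⟨ε * (1 - rate) / 24, by positivity, fun T hT hd n => ?_⟩
    rw [mem_trianglesOriented_iff] at hT
    refine (hf.infDist_iterate_le hE hEq hT n).trans_lt ?_
    have h1 := sqrt_defect_le_infDist hE hEq hT
    have h2 := mul_le_of_le_one_right (Real.sqrt_nonneg (defect T))
      (pow_le_one₀ (n := n) rate_pos.le rate_lt_one.le)
    rw [div_mul_eq_mul_div, div_lt_iff₀ hrate]
    linarith
  · obtain ⟨R, hR⟩ := hB.exists_norm_le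
    have h1 := tendsto_mul_rate_pow (8 / (1 - rate) * (2 * R))
    obtain ⟨N, hN⟩ := Filter.eventually_atTop.1 (h1.eventually_lt_const hε)
    refine ⟨N, fun n hn T hT => lt_of_le_of_lt ?_ (hN n hn)⟩
    refine (hf.infDist_iterate_le hE hEq (mem_trianglesOriented_iff.1 (hBX hT)) n).trans ?_
    have h2 : √(defect T) ≤ 2 * R := (sqrt_defect_le_norm T).trans (by linarith [hR T hT])
    have h3 := rate_pos
    rw [mul_assoc]
    gcongr

lemma IsContractedBy.isGlobalAttractor_and_exponential (hf : IsContractedBy f ρ) (hE : E ∈ triangles)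
    (hEq : IsEquilateral E) :
    IsGlobalAttractor f (trianglesOriented E) (similarityClass E) ∧
      ∃ C q : ℝ, 0 < q ∧ q < 1 ∧ ∀ T ∈ trianglesOriented E,
        ∃ L ∈ similarityClass E, ∀ n : ℕ, ‖f^[n] T - L‖ ≤ C * ‖T‖ * q ^ n := by
  -- The factor `8` of the displacement, the factor `3` of `le_norm` and the sum of the geometric
  -- series.
  refine ⟨hf.isGlobalAttractor hE hEq, 24 / (1 - rate), rate, rate_pos, rate_lt_one,
    fun T hT => ?_⟩
  obtain ⟨L, hL, h⟩ := hf.exists_limit hE hEq (mem_trianglesOriented_iff.1 hT)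
  refine ⟨L, hL, fun n => (h n).trans ?_⟩
  have hrate := sub_pos.2 rate_lt_one
  have h1 := mul_le_mul_of_nonneg_right (hf.le_norm T) (pow_pos rate_pos n).le
  rw [div_mul_eq_mul_div, div_mul_eq_mul_div]
  gcongr ?_ / _
  linarith

end Dynamics

end TriangleMap

theorem theorem3 (E : TriangleMap.Triple) (hE : E ∈ TriangleMap.triangles)
    (hEq : TriangleMap.IsEquilateral E) (θ : TriangleMap.Triple → TriangleMap.Triple)
    (hθ : θ = TriangleMap.theta ∨ θ = TriangleMap.thetaOrigin) :
    TriangleMap.IsGlobalAttractor θ (TriangleMap.trianglesOriented E)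
        (TriangleMap.similarityClass E) ∧
      ∃ C q : ℝ, 0 < q ∧ q < 1 ∧ ∀ T ∈ TriangleMap.trianglesOriented E,
        ∃ L ∈ TriangleMap.similarityClass E, ∀ n : ℕ, ‖θ^[n] T - L‖ ≤ C * ‖T‖ * q ^ n := by
  rcases hθ with rfl | rfl
  · exact TriangleMap.isContractedBy_theta.isGlobalAttractor_and_exponential hE hEq
  · exact TriangleMap.isContractedBy_thetaOrigin.isGlobalAttractor_and_exponential hE hEq

end
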